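/- A convex body is a compact convex set with nonempty interior. For a convex body $T\subset\mathbb R^n$ put $\|q\|_T=\max_{p\in T}\langle p,q\rangle$, and let $\ell_T(q_1,\dots,q_m)=\sum_{i=1}^m\|q_{i+1}-q_i\|_T$ (with $q_{m+1}=q_1$) be the length of a closed polygonal line. For a convex body $K\subset\mathbb R^n$ let $\mathcal P_m(K)$ be the set of $m$-tuples of points of $\mathbb R^n$ that are not contained in any translate of $\operatorname{int}K$, and let $$\xi_T(K)=\min_{m\ge 2}\ \min_{Q\in\mathcal P_m(K)}\ell_T(Q).$$ Let $n\ge 1$, and let $K,T\subset\mathbb R^n$ be convex bodies. Then the minima defining $\xi_T(K)$ and $\xi_T(K-K)$ are attained, and $$\xi_T(K-K)\le (n+1)\,\xi_T(K).$$ In $\mathbb R^2$ this estimate is sharp: $3$ is the least constant $c$ such that $\xi_T(K-K)\le c\,\xi_T(K)$ for all convex bodies $K,T\subset\mathbb R^2$. Moreover, if $K\subset\mathbb R^2$ is an equilateral triangle with centre at the origin and $K^\circ=\{p:\langle p,q\rangle\le 1\text{ for all }q\in K\}$ is its polar, then $K$ and $K^\circ$ are convex bodies, $\xi_{K^\circ}(K)>0$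 and $\xi_{K^\circ}(K-K)=3\,\xi_{K^\circ}(K)$. -/

import Mathlib

open scoped Pointwise

noncomputable section

namespace FinslerBilliard

/-- Convex bodies: compact convex sets with nonempty interior. -/
structure IsConvexBody {n : ℕ} (K : Set (EuclideanSpace ℝ (Fin n))) : Prop where
  convex : Convex ℝ K
  isCompact : IsCompact K
  interior_nonempty : (interior K).Nonempty

/-- The (one-sided) polar `K° = {p | ⟨p, q⟩ ≤ 1 for all q ∈ K}`. -/
def polarBody {n : ℕ} (K : Set (EuclideanSpace ℝ (Fin n))) : Set (EuclideanSpace ℝ (Fin n)) :=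
  {p | ∀ q ∈ K, inner ℝ p q ≤ 1}

/-- The possibly non-symmetric norm `‖q‖_T = max_{p ∈ T} ⟨p, q⟩`
(for a convex body `T` the supremum is a maximum). -/
def finslerNorm {n : ℕ} (T : Set (EuclideanSpace ℝ (Fin n)))
    (q : EuclideanSpace ℝ (Fin n)) : ℝ :=
  sSup ((fun p => inner ℝ p q) '' T)

/-- The length `∑ ‖q_{i+1} - q_i‖_T` of the closed polygonal line `q_1, …, q_m, q_1`;
`finRotate m` is the cyclic shift `i ↦ i + 1` of the indices. -/
def closedLength {n m : ℕ} (T : Set (EuclideanSpace ℝ (Fin n)))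
    (q : Fin m → EuclideanSpace ℝ (Fin n)) : ℝ :=
  ∑ i, finslerNorm T (q (finRotate m i) - q i)

/-- `P_m(K)`: the `m`-tuples of points that do not fit into any translate of the interior
of `K`. -/
def nonFitting {n : ℕ} (m : ℕ) (K : Set (EuclideanSpace ℝ (Fin n))) :
    Set (Fin m → EuclideanSpace ℝ (Fin n)) :=
  {q | ¬ ∃ t : EuclideanSpace ℝ (Fin n), Set.range q ⊆ t +ᵥ interior K}

/-- The lengths of all closed polygonal lines with `m ≥ 2` vertices that do not fit into any
translate of the interior of `K`. -/
def lengthSet {n : ℕ} (T K : Set (EuclideanSpace ℝ (Fin n))) : Set ℝ :=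
  {L | ∃ m : ℕ, 2 ≤ m ∧ ∃ q ∈ nonFitting m K, closedLength T q = L}

/-- `ξ_T(K) = min_{m ≥ 2} min_{Q ∈ P_m(K)} ℓ_T(Q)`. -/
def xi {n : ℕ} (T K : Set (EuclideanSpace ℝ (Fin n))) : ℝ :=
  sInf (lengthSet T K)

end FinslerBilliard

end

/-!
Let `q` be a closed polygonal line. By the triangle inequality its length does not increase when
vertices are dropped or repeated without changing their cyclic order. By Helly's theorem some
`n + 1` vertices of a line that does not fit into `int K` already do not fit, so `ξ_T(K)` is a
minimum over lines with exactly `n + 1` vertices, and translating the first vertex to the origin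
leaves a compact set of candidates. Helly's theorem, applied to the sets `x + n K` with `x ∈ K`,
also yields a translate of `(n + 1) K` containing `K - K`, and since lengths are homogeneous this
gives the bound.

For a triangle `K` with vertices `b₀`, `b₁`, `b₂` and centroid `0`, the line with steps `b₀`, `b₁`,
`b₂` has length at most `3` and does not fit into `int K`. Conversely, let `aᵢ` be the linear parts
of the barycentric coordinates. Then `max |aᵢ| < 1` cuts out an open subset of `K - K`, and
`-3 aᵢ ≤ ‖·‖_{K°}`. For a line of length less than `9`, summing the latter over pairs of vertices at
which the `aᵢ` are extremal shows that a single translation brings all `aᵢ` into `(-1, 1)` along the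
line, so it fits into `int (K - K)`. Hence `ξ(K) ≤ 3` and `ξ(K - K) ≥ 9`, and the general bound
forces equality.
-/

namespace FinslerBilliard

section Support

variable {E : Type*} [NormedAddCommGroup E] [InnerProductSpace ℝ E]

theorem exists_mem_closedBall_inner_eq {r : ℝ} (hr : 0 ≤ r) (c d : E) :
    ∃ x ∈ Metric.closedBall c r, inner ℝ x d = inner ℝ c d + r * ‖d‖ := by
  rcases eq_or_ne d 0 with rfl | hd
  · exact ⟨c, Metric.mem_closedBall_self hr, by simp⟩
  have hcancel : r / ‖d‖ * ‖d‖ = r := div_mul_cancel₀ r (norm_ne_zero_iff.2 hd)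
  refine ⟨c + (r / ‖d‖) • d, ?_, ?_⟩
  · rw [mem_closedBall_iff_norm, add_sub_cancel_left, norm_smul, norm_div, norm_norm,
      Real.norm_of_nonneg hr, hcancel]
  · rw [inner_add_left, real_inner_smul_left, real_inner_self_eq_norm_mul_norm, ← mul_assoc,
      hcancel]

end Support

variable {n m : ℕ} {K T : Set (EuclideanSpace ℝ (Fin n))}

theorem inner_le_finslerNorm (hT : Bornology.IsBounded T) {p : EuclideanSpace ℝ (Fin n)}
    (hp : p ∈ T) (d : EuclideanSpace ℝ (Fin n)) : inner ℝ p d ≤ finslerNorm T d := by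
  obtain ⟨R, hR⟩ := hT.exists_norm_le
  refine le_csSup ⟨R * ‖d‖, ?_⟩ ⟨p, hp, rfl⟩
  rintro _ ⟨x, hx, rfl⟩
  exact (real_inner_le_norm x d).trans (by gcongr; exact hR x hx)

theorem finslerNorm_le {d : EuclideanSpace ℝ (Fin n)} {c : ℝ} (hc : 0 ≤ c)
    (h : ∀ p ∈ T, inner ℝ p d ≤ c) : finslerNorm T d ≤ c :=
  Real.sSup_le (Set.forall_mem_image.2 h) hc

theorem finslerNorm_smul {c : ℝ} (hc : 0 ≤ c) (T : Set (EuclideanSpace ℝ (Fin n)))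
    (d : EuclideanSpace ℝ (Fin n)) : finslerNorm T (c • d) = c * finslerNorm T d := by
  simp only [finslerNorm, inner_smul_right_eq_smul, ← smul_eq_mul]
  rw [← Real.sSup_smul_of_nonneg hc, ← Set.image_smul, Set.image_image]

theorem finslerNorm_zero (T : Set (EuclideanSpace ℝ (Fin n))) : finslerNorm T 0 = 0 := by
  simpa using finslerNorm_smul le_rfl T 0

theorem finslerNorm_add_le (hT : Bornology.IsBounded T) (d d' : EuclideanSpace ℝ (Fin n)) :
    finslerNorm T (d + d') ≤ finslerNorm T d + finslerNorm T d' := by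
  rcases T.eq_empty_or_nonempty with rfl | hne
  · simp [finslerNorm]
  refine csSup_le (hne.image _) (Set.forall_mem_image.2 fun p hp => ?_)
  rw [inner_add_right]
  exact add_le_add (inner_le_finslerNorm hT hp d) (inner_le_finslerNorm hT hp d')

theorem finslerNorm_sub_le (hT : Bornology.IsBounded T) (x y z : EuclideanSpace ℝ (Fin n)) :
    finslerNorm T (x - z) ≤ finslerNorm T (x - y) + finslerNorm T (y - z) := by
  simpa only [sub_add_sub_cancel] using finslerNorm_add_le hT (x - y) (y - z)

theorem continuous_finslerNorm (hT : IsCompact T) : Continuous (finslerNorm T) :=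
  hT.continuous_sSup (f := fun d p => inner ℝ p d) (by fun_prop)

theorem exists_mul_norm_le_finslerNorm_add (hT : Bornology.IsBounded T)
    (hTi : (interior T).Nonempty) :
    ∃ r > 0, ∀ d, r * ‖d‖ ≤ finslerNorm T d + finslerNorm T (-d) := by
  obtain ⟨c, hc⟩ := hTi
  obtain ⟨r, hr, hball⟩ := Metric.nhds_basis_closedBall.mem_iff.1 (mem_interior_iff_mem_nhds.1 hc)
  refine ⟨r, hr, fun d => ?_⟩
  obtain ⟨x, hx, hxd⟩ := exists_mem_closedBall_inner_eq hr.le c d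
  have hd := inner_le_finslerNorm hT (hball hx) d
  have hneg := inner_le_finslerNorm hT (interior_subset hc) (-d)
  rw [inner_neg_right] at hneg
  linarith

/-- The length of the part `q_0, …, q_j` of a polygonal line, whose increments bound the lengths of
chords. -/
noncomputable def arcLength (T : Set (EuclideanSpace ℝ (Fin n)))
    (q : Fin (m + 1) → EuclideanSpace ℝ (Fin n)) : Fin (m + 1) → ℝ :=
  Fin.partialSum fun i : Fin m => finslerNorm T (q i.succ - q i.castSucc)

theorem arcLength_succ (T : Set (EuclideanSpace ℝ (Fin n)))
    (q : Fin (m + 1) → EuclideanSpace ℝ (Fin n)) (i : Fin m) :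
    arcLength T q i.succ =
      arcLength T q i.castSucc + finslerNorm T (q i.succ - q i.castSucc) :=
  Fin.partialSum_succ _ i

theorem sum_succ_sub_castSucc {G : Type*} [AddCommGroup G] (s : Fin (m + 1) → G) :
    ∑ i : Fin m, (s i.succ - s i.castSucc) = s (Fin.last m) - s 0 := by
  rw [Finset.sum_sub_distrib, sub_eq_sub_iff_add_eq_add, add_comm, ← Fin.sum_univ_succ,
    Fin.sum_univ_castSucc, add_comm]

theorem finslerNorm_sub_le_arcLength_sub (hT : Bornology.IsBounded T)
    (q : Fin (m + 1) → EuclideanSpace ℝ (Fin n)) {i j : Fin (m + 1)} (hij : i ≤ j) :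
    finslerNorm T (q j - q i) ≤ arcLength T q j - arcLength T q i := by
  induction j using Fin.induction with
  | zero => simp [Fin.le_zero_iff.1 hij, finslerNorm_zero]
  | succ j ih =>
    rcases hij.eq_or_lt with rfl | hlt
    · simp [finslerNorm_zero]
    · have hstep := finslerNorm_sub_le hT (q j.succ) (q j.castSucc) (q i)
      have hrest := ih (Fin.le_castSucc_iff.2 hlt)
      rw [arcLength_succ]
      linarith

theorem closedLength_succ (T : Set (EuclideanSpace ℝ (Fin n)))
    (q : Fin (m + 1) → EuclideanSpace ℝ (Fin n)) :
    closedLength T q = ∑ i : Fin m, finslerNorm T (q i.succ - q i.castSucc) +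
      finslerNorm T (q 0 - q (Fin.last m)) := by
  rw [closedLength, Fin.sum_univ_castSucc]
  simp only [finRotate_apply, Fin.coeSucc_eq_succ, Fin.last_add_one]

theorem closedLength_eq_arcLength_sub_add (T : Set (EuclideanSpace ℝ (Fin n)))
    (q : Fin (m + 1) → EuclideanSpace ℝ (Fin n)) :
    closedLength T q = arcLength T q (Fin.last m) - arcLength T q 0 +
      finslerNorm T (q 0 - q (Fin.last m)) := by
  simp only [closedLength_succ, ← sum_succ_sub_castSucc, arcLength_succ, add_sub_cancel_left]

theorem closedLength_comp_le (hT : Bornology.IsBounded T) {k : ℕ}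
    (q : Fin (m + 1) → EuclideanSpace ℝ (Fin n)) {e : Fin (k + 1) → Fin (m + 1)}
    (he : Monotone e) : closedLength T (q ∘ e) ≤ closedLength T q := by
  have hopen : ∑ i : Fin k, finslerNorm T (q (e i.succ) - q (e i.castSucc)) ≤
      arcLength T q (e (Fin.last k)) - arcLength T q (e 0) := by
    refine (Finset.sum_le_sum fun i _ => ?_).trans_eq (sum_succ_sub_castSucc (arcLength T q ∘ e))
    exact finslerNorm_sub_le_arcLength_sub hT q (he i.castSucc_lt_succ.le)
  have hclosing := finslerNorm_sub_le hT (q (e 0)) (q 0) (q (e (Fin.last k)))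
  have hclosing' := finslerNorm_sub_le hT (q 0) (q (Fin.last m)) (q (e (Fin.last k)))
  have hstart := finslerNorm_sub_le_arcLength_sub hT q (Fin.zero_le (e 0))
  have hend := finslerNorm_sub_le_arcLength_sub hT q (Fin.le_last (e (Fin.last k)))
  rw [closedLength_succ, closedLength_eq_arcLength_sub_add]
  simp only [Function.comp_apply]
  linarith

theorem finslerNorm_sub_add_finslerNorm_sub_le_closedLength (hT : Bornology.IsBounded T)
    (q : Fin m → EuclideanSpace ℝ (Fin n)) (i j : Fin m) :
    finslerNorm T (q j - q i) + finslerNorm T (q i - q j) ≤ closedLength T q := by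
  obtain ⟨m, rfl⟩ : ∃ k, m = k + 1 := ⟨m - 1, by have := i.pos; omega⟩
  wlog hij : i ≤ j generalizing i j
  · rw [add_comm]
    exact this j i (le_of_not_ge hij)
  have hmono : Monotone ![i, j] := Fin.monotone_iff_le_succ.2 (by simpa using hij)
  have h := closedLength_comp_le hT q hmono
  rw [closedLength_succ] at h
  simpa using h

theorem closedLength_nonneg (hT : Bornology.IsBounded T)
    (q : Fin m → EuclideanSpace ℝ (Fin n)) : 0 ≤ closedLength T q := by
  rcases m with _ | m
  · simp [closedLength]
  · simpa [finslerNorm_zero] using finslerNorm_sub_add_finslerNorm_sub_le_closedLength hT q 0 0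

theorem closedLength_smul {c : ℝ} (hc : 0 ≤ c) (T : Set (EuclideanSpace ℝ (Fin n)))
    (q : Fin m → EuclideanSpace ℝ (Fin n)) : closedLength T (c • q) = c * closedLength T q := by
  simp only [closedLength, Finset.mul_sum, Pi.smul_apply, ← smul_sub, finslerNorm_smul hc]

theorem closedLength_sub_const (T : Set (EuclideanSpace ℝ (Fin n)))
    (q : Fin m → EuclideanSpace ℝ (Fin n)) (a : EuclideanSpace ℝ (Fin n)) :
    closedLength T (fun i => q i - a) = closedLength T q := by
  simp only [closedLength, sub_sub_sub_cancel_right]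

theorem continuous_closedLength (hT : IsCompact T) :
    Continuous (closedLength T : (Fin m → EuclideanSpace ℝ (Fin n)) → ℝ) := by
  have := continuous_finslerNorm hT
  unfold closedLength
  fun_prop

theorem mem_nonFitting {q : Fin m → EuclideanSpace ℝ (Fin n)} :
    q ∈ nonFitting m K ↔ ¬ ∃ t, ∀ i, q i - t ∈ interior K := by
  simp only [nonFitting, Set.mem_ofPred_eq, Set.range_subset_iff,
    Set.mem_vadd_set_iff_neg_vadd_mem, vadd_eq_add, neg_add_eq_sub]

theorem isClosed_nonFitting (m : ℕ) (K : Set (EuclideanSpace ℝ (Fin n))) :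
    IsClosed (nonFitting m K) := by
  have hcompl : (nonFitting m K)ᶜ =
      ⋃ t : EuclideanSpace ℝ (Fin n), ⋂ i : Fin m, {q | q i - t ∈ interior K} := by
    ext q
    simp [mem_nonFitting]
  rw [← isOpen_compl_iff, hcompl]
  exact isOpen_iUnion fun t => isOpen_iInter_of_finite fun i =>
    isOpen_interior.preimage (by fun_prop)

theorem sub_const_mem_nonFitting {q : Fin m → EuclideanSpace ℝ (Fin n)}
    (hq : q ∈ nonFitting m K) (a : EuclideanSpace ℝ (Fin n)) :
    (fun i => q i - a) ∈ nonFitting m K := by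
  rw [mem_nonFitting] at hq ⊢
  rintro ⟨t, ht⟩
  exact hq ⟨a + t, fun i => by simpa only [sub_sub] using ht i⟩

theorem smul_mem_nonFitting {K' : Set (EuclideanSpace ℝ (Fin n))} {c : ℝ} (hc : c ≠ 0)
    {s : EuclideanSpace ℝ (Fin n)} (hsub : K' ⊆ s +ᵥ c • K)
    {q : Fin m → EuclideanSpace ℝ (Fin n)} (hq : q ∈ nonFitting m K) :
    c • q ∈ nonFitting m K' := by
  rw [mem_nonFitting] at hq ⊢
  rintro ⟨t, ht⟩
  refine hq ⟨c⁻¹ • (t + s), fun i => ?_⟩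
  have h := interior_mono hsub (ht i)
  rw [interior_vadd, interior_smul₀ hc, Set.mem_vadd_set_iff_neg_vadd_mem,
    Set.mem_smul_set_iff_inv_smul_mem₀ hc] at h
  convert h using 1
  simp only [Pi.smul_apply, vadd_eq_add, smul_add, smul_sub, smul_neg, inv_smul_smul₀ hc]
  abel

theorem nonFitting_nonempty (hn : 1 ≤ n) (hK : Bornology.IsBounded K) (hm : 2 ≤ m) :
    (nonFitting m K).Nonempty := by
  have : Nonempty (Fin n) := ⟨⟨0, hn⟩⟩
  obtain ⟨R, hR⟩ := hK.exists_norm_le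
  obtain ⟨w, hw⟩ := NormedSpace.exists_lt_norm ℝ (EuclideanSpace ℝ (Fin n)) (R + R)
  refine ⟨Pi.single ⟨0, by omega⟩ w, mem_nonFitting.2 ?_⟩
  rintro ⟨t, ht⟩
  have hfst := hR _ (interior_subset (ht ⟨0, by omega⟩))
  have hsnd := hR _ (interior_subset (ht ⟨1, by omega⟩))
  rw [Pi.single_eq_same] at hfst
  rw [Pi.single_eq_of_ne (by simp), zero_sub, norm_neg] at hsnd
  have hnorm := norm_le_norm_sub_add w t
  linarith

theorem exists_finset_not_fitting (hK : Convex ℝ K) {q : Fin m → EuclideanSpace ℝ (Fin n)}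
    (hq : q ∈ nonFitting m K) :
    ∃ I : Finset (Fin m), I.card ≤ n + 1 ∧ ¬ ∃ t, ∀ i ∈ I, q i - t ∈ interior K := by
  by_contra! hfit
  have hconvex : ∀ i ∈ Finset.univ, Convex ℝ ((fun t => q i - t) ⁻¹' interior K) := fun i _ =>
    hK.interior.affine_preimage (AffineMap.const ℝ _ (q i) - AffineMap.id ℝ _)
  obtain ⟨t, ht⟩ := Convex.helly_theorem' hconvex fun I _ hI => by
    obtain ⟨t, ht⟩ := hfit I (by rwa [finrank_euclideanSpace_fin] at hI)
    exact ⟨t, Set.mem_iInter₂.2 ht⟩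
  exact mem_nonFitting.1 hq ⟨t, fun i => Set.mem_iInter₂.1 ht i (Finset.mem_univ i)⟩

theorem exists_monotone_range_eq {α : Type*} [LinearOrder α] {s : Finset α} (hs : s.Nonempty)
    {k : ℕ} (hk : s.card ≤ k + 1) : ∃ e : Fin (k + 1) → α, Monotone e ∧ Set.range e = s := by
  obtain ⟨c, hc⟩ : ∃ c, s.card = c + 1 := ⟨s.card - 1, by have := hs.card_pos; omega⟩
  let trunc : Fin (k + 1) → Fin (c + 1) := fun i => ⟨min i c, by omega⟩
  have htrunc : Function.Surjective trunc := fun i =>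
    ⟨⟨i, by omega⟩, Fin.ext (min_eq_left (by simp; omega))⟩
  refine ⟨s.orderEmbOfFin hc ∘ trunc, (s.orderEmbOfFin hc).monotone.comp fun i j hij =>
    min_le_min_right c (Fin.val_le_of_le hij), ?_⟩
  rw [htrunc.range_comp, Finset.range_orderEmbOfFin]

theorem exists_monotone_comp_mem_nonFitting (hK : Convex ℝ K)
    {q : Fin m → EuclideanSpace ℝ (Fin n)} (hq : q ∈ nonFitting m K) :
    ∃ e : Fin (n + 1) → Fin m, Monotone e ∧ q ∘ e ∈ nonFitting (n + 1) K := by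
  obtain ⟨I, hcard, hI⟩ := exists_finset_not_fitting hK hq
  have hne : I.Nonempty := by
    rw [Finset.nonempty_iff_ne_empty]
    rintro rfl
    simp at hI
  obtain ⟨e, hmono, hrange⟩ := exists_monotone_range_eq hne hcard
  refine ⟨e, hmono, mem_nonFitting.2 fun ⟨t, ht⟩ => hI ⟨t, fun i hi => ?_⟩⟩
  obtain ⟨k, rfl⟩ : i ∈ Set.range e := hrange ▸ hi
  exact ht k

theorem exists_isMinOn_closedLength (hK : (nonFitting (m + 1) K).Nonempty) (hT : IsCompact T)
    (hTi : (interior T).Nonempty) :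
    ∃ q ∈ nonFitting (m + 1) K, IsMinOn (closedLength T) (nonFitting (m + 1) K) q := by
  obtain ⟨p, hp⟩ := hK
  obtain ⟨r, hr, hnorm⟩ := exists_mul_norm_le_finslerNorm_add hT.isBounded hTi
  set S : Set (Fin (m + 1) → EuclideanSpace ℝ (Fin n)) :=
    nonFitting (m + 1) K ∩ {q | q 0 = 0} ∩ {q | closedLength T q ≤ closedLength T p}
  have hclosed : IsClosed S :=
    ((isClosed_nonFitting _ K).inter (isClosed_eq (by fun_prop) continuous_const)).inter
      (isClosed_le (continuous_closedLength hT) continuous_const)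
  have hbounded : Bornology.IsBounded S := by
    refine (Metric.isBounded_closedBall (x := 0) (r := closedLength T p / r)).subset ?_
    rintro q ⟨⟨-, h0 : q 0 = 0⟩, hle : closedLength T q ≤ closedLength T p⟩
    rw [mem_closedBall_zero_iff,
      pi_norm_le_iff_of_nonneg (div_nonneg (closedLength_nonneg hT.isBounded p) hr.le)]
    intro i
    have hpair := finslerNorm_sub_add_finslerNorm_sub_le_closedLength hT.isBounded q 0 i
    rw [h0, sub_zero, zero_sub] at hpair
    rw [le_div_iff₀' hr]
    exact (hnorm (q i)).trans (hpair.trans hle)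
  have hbased : ∀ q ∈ nonFitting (m + 1) K, closedLength T q ≤ closedLength T p →
      (fun i => q i - q 0) ∈ S := fun q hq hle =>
    ⟨⟨sub_const_mem_nonFitting hq _, sub_self _⟩, (closedLength_sub_const T q _).trans_le hle⟩
  obtain ⟨q, hq, hmin⟩ := (Metric.isCompact_of_isClosed_isBounded hclosed hbounded).exists_isMinOn
    ⟨_, hbased p hp le_rfl⟩ (continuous_closedLength hT).continuousOn
  refine ⟨q, hq.1.1, isMinOn_iff.2 fun q' hq' => ?_⟩
  rcases le_total (closedLength T q') (closedLength T p) with hle | hle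
  · rw [← closedLength_sub_const T q' (q' 0)]
    exact hmin (hbased q' hq' hle)
  · exact hq.2.trans hle

theorem isLeast_lengthSet_xi (hn : 1 ≤ n) (hK : Convex ℝ K) (hKb : Bornology.IsBounded K)
    (hT : IsCompact T) (hTi : (interior T).Nonempty) : IsLeast (lengthSet T K) (xi T K) := by
  obtain ⟨q, hq, hmin⟩ :=
    exists_isMinOn_closedLength (nonFitting_nonempty hn hKb (Nat.succ_le_succ hn)) hT hTi
  have hleast : IsLeast (lengthSet T K) (closedLength T q) := by
    refine ⟨⟨n + 1, Nat.succ_le_succ hn, q, hq, rfl⟩, ?_⟩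
    rintro _ ⟨m, hm, q', hq', rfl⟩
    obtain ⟨m, rfl⟩ := Nat.exists_eq_add_of_le' (one_le_two.trans hm)
    obtain ⟨e, hmono, he⟩ := exists_monotone_comp_mem_nonFitting hK hq'
    exact (hmin he).trans (closedLength_comp_le hT.isBounded q' hmono)
  rwa [xi, hleast.csInf_eq]

theorem xi_le_closedLength (hT : Bornology.IsBounded T) (hm : 2 ≤ m)
    {q : Fin m → EuclideanSpace ℝ (Fin n)} (hq : q ∈ nonFitting m K) :
    xi T K ≤ closedLength T q := by
  refine csInf_le ⟨0, ?_⟩ ⟨m, hm, q, hq, rfl⟩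
  rintro _ ⟨m, -, q, -, rfl⟩
  exact closedLength_nonneg hT q

theorem lengthSet_nonempty (hn : 1 ≤ n) (hK : Bornology.IsBounded K)
    (T : Set (EuclideanSpace ℝ (Fin n))) : (lengthSet T K).Nonempty :=
  let ⟨q, hq⟩ := nonFitting_nonempty hn hK le_rfl
  ⟨_, 2, le_rfl, q, hq, rfl⟩

theorem xi_le_mul_xi_of_subset_vadd_smul {K' : Set (EuclideanSpace ℝ (Fin n))} (hn : 1 ≤ n)
    (hK : Bornology.IsBounded K) (hT : Bornology.IsBounded T) {c : ℝ} (hc : 0 < c)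
    {s : EuclideanSpace ℝ (Fin n)} (hsub : K' ⊆ s +ᵥ c • K) : xi T K' ≤ c * xi T K := by
  rw [← div_le_iff₀' hc]
  refine le_csInf (lengthSet_nonempty hn hK T) ?_
  rintro _ ⟨m, hm, q, hq, rfl⟩
  rw [div_le_iff₀' hc, ← closedLength_smul hc.le]
  exact xi_le_closedLength hT hm (smul_mem_nonFitting hc.ne' hsub hq)

section Minkowski

variable {E : Type*} [AddCommGroup E] [Module ℝ E] {C : Set E}

theorem sum_smul_mem_sum_smul (hC : Convex ℝ C) (hne : C.Nonempty) {ι : Type*} {s : Finset ι}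
    {w : ι → ℝ} {z : ι → E} (hw : ∀ i ∈ s, 0 ≤ w i) (hz : ∀ i ∈ s, z i ∈ C) :
    ∑ i ∈ s, w i • z i ∈ (∑ i ∈ s, w i) • C := by
  classical
  induction s using Finset.induction_on with
  | empty => simp [Set.zero_smul_set hne]
  | insert i s hi ih =>
    rw [Finset.forall_mem_insert] at hw hz
    rw [Finset.sum_insert hi, Finset.sum_insert hi,
      hC.add_smul hw.1 (Finset.sum_nonneg hw.2)]
    exact Set.add_mem_add (Set.smul_mem_smul_set hz.1) (ih hw.2 hz.2)

theorem exists_forall_sub_mem_smul_of_card_le (hC : Convex ℝ C) {N : ℕ} {I : Finset E}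
    (hI : ∀ x ∈ I, x ∈ C) (hcard : I.card ≤ N + 1) : ∃ t, ∀ x ∈ I, t - x ∈ (N : ℝ) • C := by
  classical
  rcases I.eq_empty_or_nonempty with rfl | hne
  · simp
  have hpos : (0 : ℝ) < I.card := by exact_mod_cast hne.card_pos
  have hone : 1 ≤ (N + 1 : ℝ) / I.card := by
    rw [one_le_div₀ hpos]
    exact_mod_cast hcard
  -- `N + 1` times the centroid of `I`: its weights are at least `1`, so they stay nonnegative, with
  -- total `N`, after one `x ∈ I` is subtracted.
  refine ⟨∑ y ∈ I, ((N + 1 : ℝ) / I.card) • y, fun x hx => ?_⟩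
  have hmem := sum_smul_mem_sum_smul hC ⟨x, hI x hx⟩ (s := I) (z := id)
    (w := fun y => (N + 1 : ℝ) / I.card - if y = x then 1 else 0)
    (fun y _ => by split_ifs <;> linarith) hI
  simpa [sub_smul, Finset.sum_sub_distrib, hx, mul_div_cancel₀ _ hpos.ne'] using hmem

variable [TopologicalSpace E] [T2Space E] [IsTopologicalAddGroup E] [ContinuousSMul ℝ E]
  [FiniteDimensional ℝ E]

theorem exists_forall_sub_mem_finrank_smul (hC : Convex ℝ C) (hCc : IsCompact C) :
    ∃ t, ∀ x ∈ C, t - x ∈ (Module.finrank ℝ E : ℝ) • C := by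
  obtain ⟨t, ht⟩ : (⋂ x : C, ((x : E) +ᵥ (Module.finrank ℝ E : ℝ) • C)).Nonempty := by
    refine Convex.helly_theorem_compact' (𝕜 := ℝ) (fun x => (hC.smul _).vadd _)
      (fun x => (hCc.smul _).vadd _) fun I hI => ?_
    obtain ⟨t, ht⟩ := exists_forall_sub_mem_smul_of_card_le hC
      (I := I.map (Function.Embedding.subtype _)) (by simp +contextual) (by rwa [Finset.card_map])
    refine ⟨t, Set.mem_iInter₂.2 fun x hx => ?_⟩
    rw [Set.mem_vadd_set_iff_neg_vadd_mem, vadd_eq_add, neg_add_eq_sub]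
    exact ht x (Finset.mem_map_of_mem _ hx)
  refine ⟨t, fun x hx => ?_⟩
  have h := Set.mem_iInter.1 ht ⟨x, hx⟩
  rwa [Set.mem_vadd_set_iff_neg_vadd_mem, vadd_eq_add, neg_add_eq_sub] at h

theorem exists_sub_subset_vadd_smul (hC : Convex ℝ C) (hCc : IsCompact C) :
    ∃ s : E, C - C ⊆ s +ᵥ ((Module.finrank ℝ E : ℝ) + 1) • C := by
  obtain ⟨t, ht⟩ := exists_forall_sub_mem_finrank_smul hC hCc
  refine ⟨-t, ?_⟩
  rintro _ ⟨x, hx, y, hy, rfl⟩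
  rw [Set.mem_vadd_set_iff_neg_vadd_mem, neg_neg, vadd_eq_add,
    hC.add_smul (Nat.cast_nonneg _) zero_le_one, one_smul]
  exact ⟨t - y, ht y hy, x, hx, by simp only; abel⟩

end Minkowski

theorem xi_sub_le (hn : 1 ≤ n) (hK : Convex ℝ K) (hKc : IsCompact K)
    (hT : Bornology.IsBounded T) : xi T (K - K) ≤ ((n : ℝ) + 1) * xi T K := by
  obtain ⟨s, hs⟩ := exists_sub_subset_vadd_smul hK hKc
  rw [finrank_euclideanSpace_fin] at hs
  exact xi_le_mul_xi_of_subset_vadd_smul hn hKc.isBounded hT (by positivity) hs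

section Polar

theorem polarBody_eq_biInter (K : Set (EuclideanSpace ℝ (Fin n))) :
    polarBody K = ⋂ q ∈ K, {p | inner ℝ p q ≤ 1} := by
  ext p
  simp [polarBody]

theorem convex_polarBody (K : Set (EuclideanSpace ℝ (Fin n))) : Convex ℝ (polarBody K) := by
  rw [polarBody_eq_biInter]
  exact convex_iInter₂ fun q _ =>
    convex_halfSpace_le ⟨fun p p' => inner_add_left p p' q, fun c p => real_inner_smul_left p q c⟩ 1

theorem isClosed_polarBody (K : Set (EuclideanSpace ℝ (Fin n))) : IsClosed (polarBody K) := by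
  rw [polarBody_eq_biInter]
  exact isClosed_biInter fun q _ => isClosed_le (by fun_prop) continuous_const

theorem isBounded_polarBody (h0 : 0 ∈ interior K) : Bornology.IsBounded (polarBody K) := by
  obtain ⟨r, hr, hball⟩ := Metric.nhds_basis_closedBall.mem_iff.1 (mem_interior_iff_mem_nhds.1 h0)
  refine isBounded_iff_forall_norm_le.2 ⟨1 / r, fun p hp => ?_⟩
  obtain ⟨x, hx, hxp⟩ := exists_mem_closedBall_inner_eq hr.le 0 p
  rw [inner_zero_left, zero_add, real_inner_comm] at hxp
  rw [le_div_iff₀' hr, ← hxp]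
  exact hp x (hball hx)

theorem zero_mem_interior_polarBody (hK : Bornology.IsBounded K) :
    0 ∈ interior (polarBody K) := by
  obtain ⟨R, hR, hnorm⟩ := hK.exists_pos_norm_le
  refine mem_interior_iff_mem_nhds.2 (Filter.mem_of_superset
    (Metric.closedBall_mem_nhds 0 (inv_pos.2 hR)) fun p hp q hq => ?_)
  rw [mem_closedBall_zero_iff] at hp
  calc inner ℝ p q ≤ ‖p‖ * ‖q‖ := real_inner_le_norm p q
    _ ≤ R⁻¹ * R := by gcongr; exact hnorm q hq
    _ = 1 := inv_mul_cancel₀ hR.ne'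

theorem isConvexBody_polarBody (hK : Bornology.IsBounded K) (h0 : 0 ∈ interior K) :
    IsConvexBody (polarBody K) where
  convex := convex_polarBody K
  isCompact := Metric.isCompact_of_isClosed_isBounded (isClosed_polarBody K)
    (isBounded_polarBody h0)
  interior_nonempty := ⟨0, zero_mem_interior_polarBody hK⟩

theorem finslerNorm_polarBody_le_one {x : EuclideanSpace ℝ (Fin n)} (hx : x ∈ K) :
    finslerNorm (polarBody K) x ≤ 1 :=
  finslerNorm_le zero_le_one fun _ hp => hp x hx

theorem le_finslerNorm_polarBody (h0 : 0 ∈ interior K) {f : EuclideanSpace ℝ (Fin n) →ₗ[ℝ] ℝ}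
    (hf : ∀ x ∈ K, f x ≤ 1) (d : EuclideanSpace ℝ (Fin n)) :
    f d ≤ finslerNorm (polarBody K) d := by
  obtain ⟨p, hp⟩ : ∃ p, ∀ x, inner ℝ p x = f x :=
    ⟨(InnerProductSpace.toDual ℝ _).symm f.toContinuousLinearMap, fun _ =>
      InnerProductSpace.toDual_symm_apply⟩
  rw [← hp d]
  exact inner_le_finslerNorm (isBounded_polarBody h0) (fun x hx => (hp x).trans_le (hf x hx)) d

end Polar

section AffineBasis

variable {ι V : Type*} [AddCommGroup V] [Module ℝ V] (b : AffineBasis ι ℝ V)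

theorem coord_sub (i : ι) (x y : V) : b.coord i (x - y) = b.coord i x - (b.coord i).linear y := by
  rw [sub_eq_neg_add, ← vadd_eq_add, (b.coord i).map_vadd, map_neg, vadd_eq_add, neg_add_eq_sub]

variable [Fintype ι]

theorem sum_coord_linear (x : V) : ∑ i, (b.coord i).linear x = 0 := by
  have h := b.sum_coord_apply_eq_one (0 - x)
  simpa only [coord_sub, Finset.sum_sub_distrib, b.sum_coord_apply_eq_one, sub_eq_self] using h

theorem coord_linear_sum_smul {w : ι → ℝ} (hw : ∑ i, w i = 0) (i : ι) :
    (b.coord i).linear (∑ j, w j • b j) = w i := by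
  classical
  have hsum : ∑ j, (b.coord j 0 - w j) = 1 := by
    rw [Finset.sum_sub_distrib, b.sum_coord_apply_eq_one, hw, sub_zero]
  have hcoord := b.coord_apply_combination_of_mem (Finset.mem_univ i) hsum
  rw [Finset.affineCombination_eq_linear_combination _ _ _ hsum] at hcoord
  simp only [sub_smul, Finset.sum_sub_distrib, b.linear_combination_coord_eq_self,
    coord_sub] at hcoord
  linarith

theorem sum_coord_linear_smul (x : V) : ∑ i, (b.coord i).linear x • b i = x := by
  have h := b.linear_combination_coord_eq_self (0 - x)
  simp only [coord_sub, sub_smul, Finset.sum_sub_distrib] at h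
  rwa [b.linear_combination_coord_eq_self, sub_right_inj] at h

theorem sum_eq_zero_of_centroid_eq_zero (hb : Finset.univ.centroid ℝ b = 0) : ∑ i, b i = 0 := by
  have := b.nonempty
  have hcoord (i : ι) : b.coord i 0 = (Fintype.card ι : ℝ)⁻¹ := by
    rw [← hb, b.coord_apply_centroid (Finset.mem_univ i), Finset.card_univ]
  have h := b.linear_combination_coord_eq_self 0
  simpa only [hcoord, ← Finset.smul_sum, smul_eq_zero, inv_eq_zero, Nat.cast_eq_zero,
    Fintype.card_ne_zero, false_or] using h

theorem coord_eq_linear_add_of_centroid_eq_zero (hb : Finset.univ.centroid ℝ b = 0) (i : ι)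
    (x : V) : b.coord i x = (b.coord i).linear x + (Fintype.card ι : ℝ)⁻¹ := by
  have h := b.coord_apply_centroid (Finset.mem_univ i)
  rw [hb, Finset.card_univ] at h
  rw [← h, ← vadd_eq_add, ← (b.coord i).map_vadd, vadd_eq_add, add_zero]

theorem mem_convexHull_sub_convexHull_of_sum_posPart_le_one {x : V}
    (hx : ∑ i, ((b.coord i).linear x)⁺ ≤ 1) :
    x ∈ convexHull ℝ (Set.range b) - convexHull ℝ (Set.range b) := by
  have := b.nonempty
  have hpos_neg : ∑ i, ((b.coord i).linear x)⁻ = ∑ i, ((b.coord i).linear x)⁺ := by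
    rw [eq_comm, ← sub_eq_zero, ← Finset.sum_sub_distrib]
    simp only [posPart_sub_negPart, sum_coord_linear]
  set S := ∑ i, ((b.coord i).linear x)⁺
  -- The positive and the negative parts of the coordinates have the same total `S ≤ 1`; spreading
  -- the missing mass `1 - S` evenly over both does not change their difference.
  have hcomb (w : ι → ℝ) (hw : ∀ i, 0 ≤ w i) (hwS : ∑ i, w i = S) :
      ∑ i, (w i + (1 - S) / Fintype.card ι) • b i ∈ convexHull ℝ (Set.range b) := by
    refine (convex_convexHull ℝ _).sum_mem (fun i _ => ?_) ?_
      fun i _ => subset_convexHull ℝ _ (Set.mem_range_self i)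
    · exact add_nonneg (hw i) (div_nonneg (sub_nonneg.2 hx) (Nat.cast_nonneg _))
    · rw [Finset.sum_add_distrib, hwS, Finset.sum_const, Finset.card_univ, nsmul_eq_mul,
        mul_div_cancel₀ _ (Nat.cast_ne_zero.2 Fintype.card_ne_zero), add_sub_cancel]
  refine ⟨_, hcomb _ (fun i => posPart_nonneg _) rfl, _,
    hcomb _ (fun i => negPart_nonneg _) hpos_neg, ?_⟩
  simp only [← Finset.sum_sub_distrib, ← sub_smul, add_sub_add_right_eq_sub, posPart_sub_negPart,
    sum_coord_linear_smul]

end AffineBasis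

section Existence

variable (V : Type*) {ι : Type*} [Fintype ι] [AddCommGroup V] [Module ℝ V] [FiniteDimensional ℝ V]

theorem exists_affineBasis_centroid_eq_zero (h : Fintype.card ι = Module.finrank ℝ V + 1) :
    ∃ b : AffineBasis ι ℝ V, Finset.univ.centroid ℝ b = 0 := by
  obtain ⟨b⟩ := AffineBasis.exists_affineBasis_of_finiteDimensional (k := ℝ) (P := V) h
  have := b.nonempty
  refine ⟨-Finset.univ.centroid ℝ b +ᵥ b, ?_⟩
  have hcoe : ⇑(-Finset.univ.centroid ℝ b +ᵥ b) = fun i => b i -ᵥ Finset.univ.centroid ℝ b := by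
    ext1 i
    rw [AffineBasis.coe_vadd, Pi.vadd_apply, vadd_eq_add, vsub_eq_sub, neg_add_eq_sub]
  rw [hcoe, ← Finset.centroid_vsub_const ℝ Finset.univ Finset.univ_nonempty, vsub_self]

variable {V}

theorem exists_affineBasis_coe_eq {p : ι → V} (hp : AffineIndependent ℝ p)
    (h : Fintype.card ι = Module.finrank ℝ V + 1) : ∃ b : AffineBasis ι ℝ V, ⇑b = p :=
  ⟨⟨p, hp, hp.affineSpan_eq_top_iff_card_eq_finrank_add_one.2 h⟩, rfl⟩

end Existence

section Simplex

variable {ι : Type*} (b : AffineBasis ι ℝ (EuclideanSpace ℝ (Fin n)))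

theorem isCompact_convexHull_range [Finite ι] : IsCompact (convexHull ℝ (Set.range b)) :=
  (Set.finite_range b).isCompact_convexHull ℝ

theorem isConvexBody_convexHull_range [Finite ι] :
    IsConvexBody (convexHull ℝ (Set.range b)) where
  convex := convex_convexHull ℝ _
  isCompact := isCompact_convexHull_range b
  interior_nonempty :=
    let _ := Fintype.ofFinite ι
    ⟨_, b.centroid_mem_interior_convexHull⟩

variable [Fintype ι]

variable {b} in
theorem zero_mem_interior_convexHull_range (hb : Finset.univ.centroid ℝ b = 0) :
    0 ∈ interior (convexHull ℝ (Set.range b)) :=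
  hb ▸ b.centroid_mem_interior_convexHull

variable {b} in
theorem isConvexBody_polarBody_convexHull (hb : Finset.univ.centroid ℝ b = 0) :
    IsConvexBody (polarBody (convexHull ℝ (Set.range b))) :=
  isConvexBody_polarBody (isCompact_convexHull_range b).isBounded
    (zero_mem_interior_convexHull_range hb)

theorem mem_nonFitting_of_sum_coord_nonpos {q : Fin m → EuclideanSpace ℝ (Fin n)} (k : ι → Fin m)
    (hq : ∑ i, b.coord i (q (k i)) ≤ 0) : q ∈ nonFitting m (convexHull ℝ (Set.range b)) := by
  have := b.nonempty
  rw [mem_nonFitting, b.interior_convexHull]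
  rintro ⟨t, ht⟩
  have hpos : 0 < ∑ i, b.coord i (q (k i) - t) :=
    Finset.sum_pos (fun i _ => ht (k i) i) Finset.univ_nonempty
  simp only [coord_sub, Finset.sum_sub_distrib, sum_coord_linear, sub_zero] at hpos
  exact hpos.not_ge hq

variable {b} in
theorem neg_card_mul_coord_linear_le_finslerNorm (hb : Finset.univ.centroid ℝ b = 0) (i : ι)
    (d : EuclideanSpace ℝ (Fin n)) :
    -(Fintype.card ι * (b.coord i).linear d) ≤
      finslerNorm (polarBody (convexHull ℝ (Set.range b))) d := by
  have := b.nonempty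
  refine le_finslerNorm_polarBody (zero_mem_interior_convexHull_range hb)
    (f := -((Fintype.card ι : ℝ) • (b.coord i).linear)) (fun x hx => ?_) d
  rw [b.convexHull_eq_nonneg_coord] at hx
  have hcoord := hx i
  rw [coord_eq_linear_add_of_centroid_eq_zero b hb] at hcoord
  have hmul := mul_nonneg (Nat.cast_nonneg (Fintype.card ι)) hcoord
  rw [mul_add, mul_inv_cancel₀ (Nat.cast_ne_zero.2 Fintype.card_ne_zero)] at hmul
  simp only [LinearMap.neg_apply, LinearMap.smul_apply, smul_eq_mul]
  linarith

end Simplex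

section Translate

theorem exists_sum_eq_zero_of_lt {ι : Type*} [Fintype ι] {lo hi : ι → ℝ}
    (hlt : ∀ i, lo i < hi i) (hlo : ∑ i, lo i < 0) (hhi : 0 < ∑ i, hi i) :
    ∃ t : ι → ℝ, ∑ i, t i = 0 ∧ ∀ i, lo i < t i ∧ t i < hi i := by
  set A := ∑ i, lo i
  set B := ∑ i, hi i
  have hAB : 0 < B - A := by linarith
  refine ⟨fun i => (B * lo i - A * hi i) / (B - A), ?_, fun i => ⟨?_, ?_⟩⟩
  · rw [← Finset.sum_div, Finset.sum_sub_distrib, ← Finset.mul_sum, ← Finset.mul_sum, mul_comm,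
      sub_self, zero_div]
  · rw [lt_div_iff₀ hAB]
    nlinarith [hlt i]
  · rw [div_lt_iff₀ hAB]
    nlinarith [hlt i]

variable {κ : Type*} {a : Fin 3 → κ → ℝ} {D : κ → κ → ℝ}

theorem sum_apply_lt_three (ha : ∀ k, ∑ i, a i k = 0) (hD : ∀ i j k, a i j - a i k ≤ D j k)
    (hD3 : ∀ j k, D j k + D k j < 3) (k : Fin 3 → κ) : ∑ i, a i (k i) < 3 := by
  -- Since each `∑ i, a i (k j)` vanishes, `3 * ∑ i, a i (k i)` is the sum of the six differences
  -- `a i (k i) - a i (k j)` with `i ≠ j`, which pair up into three sums `D x y + D y x`.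
  simp only [Fin.sum_univ_three] at ha ⊢
  linarith [ha (k 0), ha (k 1), ha (k 2), hD 0 (k 0) (k 1), hD 0 (k 0) (k 2), hD 1 (k 1) (k 0),
    hD 1 (k 1) (k 2), hD 2 (k 2) (k 0), hD 2 (k 2) (k 1), hD3 (k 0) (k 1), hD3 (k 0) (k 2),
    hD3 (k 1) (k 2)]

theorem neg_three_lt_sum_apply (ha : ∀ k, ∑ i, a i k = 0)
    (hD : ∀ i j k, a i j - a i k ≤ D j k) (hD3 : ∀ j k, D j k + D k j < 3) (k : Fin 3 → κ) :
    -3 < ∑ i, a i (k i) := by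
  have h := sum_apply_lt_three (a := -a) (D := Function.swap D) (by simpa using ha)
    (fun i j l => by have := hD i l j; simpa [Function.swap] using (by linarith))
    (fun j l => hD3 l j) k
  simp only [Pi.neg_apply, Finset.sum_neg_distrib] at h
  linarith

theorem apply_sub_apply_lt_two (ha : ∀ k, ∑ i, a i k = 0)
    (hD : ∀ i j k, a i j - a i k ≤ D j k) (hD3 : ∀ j k, D j k + D k j < 3) (i : Fin 3)
    (j k : κ) : a i j - a i k < 2 := by
  simp only [Fin.sum_univ_three] at ha
  fin_cases i <;> simp only [Fin.zero_eta, Fin.mk_one, Fin.reduceFinMk] <;>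
    linarith [ha j, ha k, hD 0 j k, hD 1 j k, hD 2 j k, hD 0 k j, hD 1 k j, hD 2 k j, hD3 j k]

theorem exists_sum_eq_zero_forall_abs_add_lt_one [Finite κ] [Nonempty κ]
    (ha : ∀ k, ∑ i, a i k = 0) (hD : ∀ i j k, a i j - a i k ≤ D j k)
    (hD3 : ∀ j k, D j k + D k j < 3) :
    ∃ t : Fin 3 → ℝ, ∑ i, t i = 0 ∧ ∀ i k, |a i k + t i| < 1 := by
  choose kmax hmax using fun i => Finite.exists_max (a i)
  choose kmin hmin using fun i => Finite.exists_min (a i)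
  obtain ⟨t, hsum, ht⟩ := exists_sum_eq_zero_of_lt
    (lo := fun i => -1 - a i (kmin i)) (hi := fun i => 1 - a i (kmax i))
    (fun i => by linarith [apply_sub_apply_lt_two ha hD hD3 i (kmax i) (kmin i)])
    (by
      have h := neg_three_lt_sum_apply ha hD hD3 kmin
      simp only [Fin.sum_univ_three] at h ⊢
      linarith)
    (by
      have h := sum_apply_lt_three ha hD hD3 kmax
      simp only [Fin.sum_univ_three] at h ⊢
      linarith)
  refine ⟨t, hsum, fun i k => abs_lt.2 ⟨?_, ?_⟩⟩
  · linarith [(ht i).1, hmin i k]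
  · linarith [(ht i).2, hmax i k]

end Translate

section Triangle

theorem sum_posPart_le_one {a : Fin 3 → ℝ} (ha : ∑ i, a i = 0) (h : ∀ i, |a i| ≤ 1) :
    ∑ i, (a i)⁺ ≤ 1 := by
  simp only [Fin.sum_univ_three, posPart_def] at ha ⊢
  have h₀ := abs_le.1 (h 0)
  have h₁ := abs_le.1 (h 1)
  have h₂ := abs_le.1 (h 2)
  rcases le_total (a 0) 0 with s₀ | s₀ <;> rcases le_total (a 1) 0 with s₁ | s₁ <;>
    rcases le_total (a 2) 0 with s₂ | s₂ <;> simp only [sup_of_le_left, sup_of_le_right, *] <;>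
    linarith

variable {b : AffineBasis (Fin 3) ℝ (EuclideanSpace ℝ (Fin 2))}

theorem mem_interior_convexHull_sub_convexHull_of_abs_lt_one {x : EuclideanSpace ℝ (Fin 2)}
    (hx : ∀ i, |(b.coord i).linear x| < 1) :
    x ∈ interior (convexHull ℝ (Set.range b) - convexHull ℝ (Set.range b)) := by
  have hopen : IsOpen {y | ∀ i, |(b.coord i).linear y| < 1} := by
    simp only [Set.ofPred_forall]
    exact isOpen_iInter_of_finite fun i =>
      isOpen_lt ((b.coord i).linear.continuous_of_finiteDimensional.abs) continuous_const
  refine interior_maximal (fun y hy => ?_) hopen hx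
  exact mem_convexHull_sub_convexHull_of_sum_posPart_le_one b
    (sum_posPart_le_one (sum_coord_linear b y) fun i => (hy i).le)

theorem xi_polarBody_convexHull_le_three (hb : Finset.univ.centroid ℝ b = 0) :
    xi (polarBody (convexHull ℝ (Set.range b))) (convexHull ℝ (Set.range b)) ≤ 3 := by
  set K := convexHull ℝ (Set.range b)
  have hnorm (i : Fin 3) : finslerNorm (polarBody K) (b i) ≤ 1 :=
    finslerNorm_polarBody_le_one (subset_convexHull ℝ _ (Set.mem_range_self i))
  -- The closed polygonal line with the three steps `b 0`, `b 1` and `b 2`.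
  set q := ![0, b 0, -b 2]
  have hmem : q ∈ nonFitting 3 K := by
    refine mem_nonFitting_of_sum_coord_nonpos b id (le_of_eq ?_)
    have hself := b.coord_apply_eq 2
    have hne := b.coord_apply_ne (show (1 : Fin 3) ≠ 0 by decide)
    simp only [coord_eq_linear_add_of_centroid_eq_zero b hb, Fintype.card_fin] at hself hne ⊢
    simp only [Fin.sum_univ_three, id, q, Matrix.cons_val, map_zero, map_neg]
    linarith
  have hstep : -b 2 - b 0 = b 1 := by
    have hsum := sum_eq_zero_of_centroid_eq_zero b hb
    rw [Fin.sum_univ_three] at hsum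
    rw [← sub_eq_zero, ← neg_eq_zero, ← hsum]
    abel
  have hlength : closedLength (polarBody K) q = ∑ i, finslerNorm (polarBody K) (b i) := by
    rw [closedLength_succ, Fin.sum_univ_two, Fin.sum_univ_three, ← hstep]
    simp [q]
  calc xi (polarBody K) K ≤ closedLength (polarBody K) q :=
        xi_le_closedLength (isConvexBody_polarBody_convexHull hb).isCompact.isBounded
          (by norm_num) hmem
    _ = ∑ i, finslerNorm (polarBody K) (b i) := hlength
    _ ≤ ∑ _i : Fin 3, 1 := Finset.sum_le_sum fun i _ => hnorm i
    _ = 3 := by simp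

theorem nine_le_xi_polarBody_convexHull_sub (hb : Finset.univ.centroid ℝ b = 0) :
    9 ≤ xi (polarBody (convexHull ℝ (Set.range b)))
      (convexHull ℝ (Set.range b) - convexHull ℝ (Set.range b)) := by
  set K := convexHull ℝ (Set.range b)
  have hK : Bornology.IsBounded (K - K) :=
    (isCompact_convexHull_range b).isBounded.sub (isCompact_convexHull_range b).isBounded
  refine le_csInf (lengthSet_nonempty one_le_two hK _) ?_
  rintro _ ⟨m, hm, q, hq, rfl⟩
  by_contra! hlt
  have : Nonempty (Fin m) := ⟨⟨0, by omega⟩⟩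
  obtain ⟨t, hsum, ht⟩ := exists_sum_eq_zero_forall_abs_add_lt_one
    (a := fun i k => (b.coord i).linear (q k))
    (D := fun j k => finslerNorm (polarBody K) (q k - q j) / 3)
    (fun k => sum_coord_linear b (q k))
    (fun i j k => by
      have h := neg_card_mul_coord_linear_le_finslerNorm hb i (q k - q j)
      rw [map_sub, Fintype.card_fin] at h
      push_cast at h
      linarith)
    (fun j k => by
      have h := finslerNorm_sub_add_finslerNorm_sub_le_closedLength
        (isConvexBody_polarBody_convexHull hb).isCompact.isBounded q j k
      linarith)
  refine mem_nonFitting.1 hq ⟨-∑ i, t i • b i, fun k => ?_⟩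
  refine mem_interior_convexHull_sub_convexHull_of_abs_lt_one fun i => ?_
  rw [sub_neg_eq_add, map_add, coord_linear_sum_smul b hsum]
  exact ht i k

theorem xi_polarBody_convexHull_sub_le (hb : Finset.univ.centroid ℝ b = 0) :
    xi (polarBody (convexHull ℝ (Set.range b)))
        (convexHull ℝ (Set.range b) - convexHull ℝ (Set.range b)) ≤
      3 * xi (polarBody (convexHull ℝ (Set.range b))) (convexHull ℝ (Set.range b)) := by
  simpa only [Nat.cast_ofNat, two_add_one_eq_three] using
    xi_sub_le one_le_two (convex_convexHull ℝ (Set.range b)) (isCompact_convexHull_range b)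
      (isConvexBody_polarBody_convexHull hb).isCompact.isBounded

theorem xi_polarBody_convexHull_pos (hb : Finset.univ.centroid ℝ b = 0) :
    0 < xi (polarBody (convexHull ℝ (Set.range b))) (convexHull ℝ (Set.range b)) := by
  linarith [xi_polarBody_convexHull_sub_le hb, nine_le_xi_polarBody_convexHull_sub hb]

theorem xi_polarBody_convexHull_sub_eq (hb : Finset.univ.centroid ℝ b = 0) :
    xi (polarBody (convexHull ℝ (Set.range b)))
        (convexHull ℝ (Set.range b) - convexHull ℝ (Set.range b)) =
      3 * xi (polarBody (convexHull ℝ (Set.range b))) (convexHull ℝ (Set.range b)) :=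
  (xi_polarBody_convexHull_sub_le hb).antisymm <| by
    linarith [xi_polarBody_convexHull_le_three hb, nine_le_xi_polarBody_convexHull_sub hb]

end Triangle

end FinslerBilliard

open FinslerBilliard

theorem mainTheorem2_general :
    (∀ n : ℕ, 1 ≤ n → ∀ K T : Set (EuclideanSpace ℝ (Fin n)),
      Convex ℝ K → IsCompact K → IsCompact T → (interior T).Nonempty →
        IsLeast (lengthSet T K) (xi T K) ∧
        IsLeast (lengthSet T (K - K)) (xi T (K - K)) ∧
        xi T (K - K) ≤ ((n : ℝ) + 1) * xi T K) ∧
    IsLeast {c : ℝ | ∀ K T : Set (EuclideanSpace ℝ (Fin 2)),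
      IsConvexBody K → IsConvexBody T → xi T (K - K) ≤ c * xi T K} 3 ∧
    (∀ (s : Affine.Triangle ℝ (EuclideanSpace ℝ (Fin 2))) (K : Set (EuclideanSpace ℝ (Fin 2))),
      s.centroid = 0 → K = convexHull ℝ (Set.range s.points) →
        IsConvexBody K ∧ IsConvexBody (polarBody K) ∧ 0 < xi (polarBody K) K ∧
        xi (polarBody K) (K - K) = 3 * xi (polarBody K) K) := by
  refine ⟨fun n hn K T hK hKc hT hTi => ?_, ?_, ?_⟩
  · have hsub : Convex ℝ (K - K) := hK.sub hK
    have hsubc : IsCompact (K - K) := sub_eq_add_neg K K ▸ hKc.add hKc.neg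
    exact ⟨isLeast_lengthSet_xi hn hK hKc.isBounded hT hTi,
      isLeast_lengthSet_xi hn hsub hsubc.isBounded hT hTi, xi_sub_le hn hK hKc hT.isBounded⟩
  · refine ⟨fun K T hK hT => ?_, fun c hc => ?_⟩
    · simpa only [Nat.cast_ofNat, two_add_one_eq_three] using
        xi_sub_le one_le_two hK.convex hK.isCompact hT.isCompact.isBounded
    · obtain ⟨b, hb⟩ := exists_affineBasis_centroid_eq_zero (ι := Fin 3)
        (EuclideanSpace ℝ (Fin 2)) (by simp)
      have hle := hc _ _ (isConvexBody_convexHull_range b) (isConvexBody_polarBody_convexHull hb)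
      rw [xi_polarBody_convexHull_sub_eq hb] at hle
      exact le_of_mul_le_mul_right hle (xi_polarBody_convexHull_pos hb)
  · rintro s _ hs rfl
    obtain ⟨b, hb⟩ := exists_affineBasis_coe_eq s.independent (by simp)
    rw [Affine.Simplex.centroid, ← hb] at hs
    rw [← hb]
    exact ⟨isConvexBody_convexHull_range b, isConvexBody_polarBody_convexHull hs,
      xi_polarBody_convexHull_pos hs, xi_polarBody_convexHull_sub_eq hs⟩

theorem mainTheorem2 :
    -- the minima are attained and the estimate holds, in every dimension
    (∀ n : ℕ, 1 ≤ n → ∀ K T : Set (EuclideanSpace ℝ (Fin n)),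
      FinslerBilliard.IsConvexBody K → FinslerBilliard.IsConvexBody T →
        IsLeast (FinslerBilliard.lengthSet T K) (FinslerBilliard.xi T K) ∧
        IsLeast (FinslerBilliard.lengthSet T (K - K)) (FinslerBilliard.xi T (K - K)) ∧
        FinslerBilliard.xi T (K - K) ≤ ((n : ℝ) + 1) * FinslerBilliard.xi T K) ∧
    -- in the plane the constant `3` is the best possible
    IsLeast {c : ℝ | ∀ K T : Set (EuclideanSpace ℝ (Fin 2)),
      FinslerBilliard.IsConvexBody K → FinslerBilliard.IsConvexBody T →
        FinslerBilliard.xi T (K - K) ≤ c * FinslerBilliard.xi T K} 3 ∧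
    -- equality for an equilateral triangle `K` centred at the origin and `T = K°`
    (∀ (s : Affine.Triangle ℝ (EuclideanSpace ℝ (Fin 2))) (K : Set (EuclideanSpace ℝ (Fin 2))),
      s.Equilateral → s.centroid = 0 → K = convexHull ℝ (Set.range s.points) →
        FinslerBilliard.IsConvexBody K ∧
        FinslerBilliard.IsConvexBody (FinslerBilliard.polarBody K) ∧
        0 < FinslerBilliard.xi (FinslerBilliard.polarBody K) K ∧
        FinslerBilliard.xi (FinslerBilliard.polarBody K) (K - K) =
          3 * FinslerBilliard.xi (FinslerBilliard.polarBody K) K) := by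
  exact ⟨fun n hn K T hK hT => mainTheorem2_general.1 n hn K T hK.convex hK.isCompact hT.isCompact
    hT.interior_nonempty, mainTheorem2_general.2.1, fun s K _ => mainTheorem2_general.2.2 s K⟩
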